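/- Let $F$ be a field of characteristic different from $2$ and let $A$ be an $F$-algebra, not necessarily associative, commutative or unital. For $a\in A$ let $L_a\colon y\mapsto ay$ and $R_a\colon y\mapsto ya$, and let $A_\mu(L_a)$, $A_\mu(R_a)$ denote their $\mu$-eigenspaces. For $\lambda,\delta\in F\setminus\{0,1\}$, an idempotent $a=a^2\in A$ is called a primitive axis of type $(\lambda,\delta)$ if the following hold: (1) $A_1(L_a)=Fa=A_1(R_a)$; (2) $A=\bigl(A_1(L_a)\oplus A_0(L_a)\bigr)\oplus A_\lambda(L_a)$ and $A=\bigl(A_1(R_a)\oplus A_0(R_a)\bigr)\oplus A_\delta(R_a)$, and each of these two decompositions is a $\mathbb Z/2$-grading of $A$, whose even part is the sum in parentheses and whose odd part is the last summand; (3) $a(ya)=(ay)a$ for all $y\in A$; (4) $A_\lambda(L_a)\cap A_0(R_a)=0=A_0(L_a)\cap A_\delta(R_a)$ (the axis is of Jordan type). The algebra $A$ is called a primitive axial algebra of Jordan type if it is generated as an $F$-algebra by a set (possibly infinite) of primitive axes, not necessarily of the same type. **Theorem.** Every primitive axial algebra $A$ of Jordan type is flexible, i.e. $(xy)x=x(yx)$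 for all $x,y\in A$. -/

import Mathlib

/-- `A = P ⊕ N` is a `ℤ/2`-grading of the (nonassociative) algebra `A`, with even part `P` and
odd part `N`. -/
structure IsZ2Grading {F A : Type*} [Field F] [NonUnitalNonAssocRing A] [Module F A]
    (P N : Submodule F A) : Prop where
  isCompl : IsCompl P N
  even_mul_even : ∀ x ∈ P, ∀ y ∈ P, x * y ∈ P
  even_mul_odd : ∀ x ∈ P, ∀ y ∈ N, x * y ∈ N
  odd_mul_even : ∀ x ∈ N, ∀ y ∈ P, x * y ∈ N
  odd_mul_odd : ∀ x ∈ N, ∀ y ∈ N, x * y ∈ P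

/-- `A_μ(L_a)`: the `μ`-eigenspace of the left multiplication `y ↦ a y`. -/
def leftEigenspace {F A : Type*} [Field F] [NonUnitalNonAssocRing A] [Module F A]
    [IsScalarTower F A A] [SMulCommClass F A A] (a : A) (μ : F) : Submodule F A :=
  Module.End.eigenspace (LinearMap.mulLeft F a) μ

/-- `A_μ(R_a)`: the `μ`-eigenspace of the right multiplication `y ↦ y a`. -/
def rightEigenspace {F A : Type*} [Field F] [NonUnitalNonAssocRing A] [Module F A]
    [IsScalarTower F A A] [SMulCommClass F A A] (a : A) (μ : F) : Submodule F A :=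
  Module.End.eigenspace (LinearMap.mulRight F a) μ

/-- The idempotent `a` is a primitive left axis of type `lam`, where `lam ∉ {0, 1}`:
`A_1(L_a) = F a` and `A = (A_1(L_a) ⊕ A_0(L_a)) ⊕ A_lam(L_a)` is a `ℤ/2`-grading.
(The inner sum is direct because eigenspaces for distinct eigenvalues are independent.) -/
structure IsPrimitiveLeftAxis {F A : Type*} [Field F] [NonUnitalNonAssocRing A] [Module F A]
    [IsScalarTower F A A] [SMulCommClass F A A] (a : A) (lam : F) : Prop where
  idem : a * a = a
  ne_zero : lam ≠ 0
  ne_one : lam ≠ 1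
  primitive : leftEigenspace a (1 : F) = Submodule.span F {a}
  fusion : IsZ2Grading (leftEigenspace a (1 : F) ⊔ leftEigenspace a (0 : F))
    (leftEigenspace a lam)

/-- The idempotent `a` is a primitive right axis of type `del`, where `del ∉ {0, 1}`. -/
structure IsPrimitiveRightAxis {F A : Type*} [Field F] [NonUnitalNonAssocRing A] [Module F A]
    [IsScalarTower F A A] [SMulCommClass F A A] (a : A) (del : F) : Prop where
  idem : a * a = a
  ne_zero : del ≠ 0
  ne_one : del ≠ 1
  primitive : rightEigenspace a (1 : F) = Submodule.span F {a}
  fusion : IsZ2Grading (rightEigenspace a (1 : F) ⊔ rightEigenspace a (0 : F))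
    (rightEigenspace a del)

/-- `a` is a primitive (two-sided) axis of type `(lam, del)`, of Jordan type: a primitive left axis
of type `lam` and a primitive right axis of type `del`, with `L_a R_a = R_a L_a` and
`A_{lam,0}(a) = A_{0,del}(a) = 0`. The two `ℤ/2`-gradings of the one-sided axes together are the
`ℤ/2 × ℤ/2`-grading of `A` by the joint eigenspaces `A_{μ,η}(a) = A_μ(L_a) ∩ A_η(R_a)`. -/
structure IsPrimitiveAxis {F A : Type*} [Field F] [NonUnitalNonAssocRing A] [Module F A]
    [IsScalarTower F A A] [SMulCommClass F A A] (a : A) (lam del : F) : Prop where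
  left : IsPrimitiveLeftAxis a lam
  right : IsPrimitiveRightAxis a del
  comm : ∀ y : A, a * (y * a) = (a * y) * a
  lam_zero : leftEigenspace a lam ⊓ rightEigenspace a (0 : F) = ⊥
  zero_del : leftEigenspace a (0 : F) ⊓ rightEigenspace a del = ⊥

/-- `A` is a primitive axial algebra of Jordan type over `F`: it is generated, as a (not
necessarily unital, commutative or associative) `F`-algebra, by a set of primitive axes, whose
types may differ. -/
def IsPAJ (F A : Type*) [Field F] [NonUnitalNonAssocRing A] [Module F A]
    [IsScalarTower F A A] [SMulCommClass F A A] : Prop :=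
  ∃ X : Set A, (∀ a ∈ X, ∃ lam del : F, IsPrimitiveAxis a lam del) ∧
    NonUnitalAlgebra.adjoin F X = ⊤

/-! Conditions (3) and (4) make the left and right eigenspaces of an axis `a` coincide, so both
multiplications by `a` are described by one functional `φ` and one odd projection `π`. Since the
characteristic is not 2, `π b` is half of `b` minus its Miyamoto image, which is again an axis when
`b` is; hence products of axes are combinations of axes, and axes span `A`.

Flexibility is equivalent to the vanishing of `flexDefect x y z`, which is linear in `x` and `z`, so
two axes `a`, `b` and an arbitrary `y` suffice. If both are commutative, the defect cancels.
Otherwise computing `ab` and `ba` from either side leaves the four configurations of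
`classification`. Congruent axes are handled by comparing flexibility of `a + u` and `a - u`. In the
orthogonal and opposite cases the defect of the even part of `b` is a multiple of `a`, killed
because `φ` is invariant under the involution of `b`. -/

section Axes

variable {F A : Type*} [Field F] [NonUnitalNonAssocRing A] [Module F A]

/-- An equational description of a nonzero primitive axis `a` of type `(l, d)`: `φ y` is the
coefficient of `a` in `y`, and `π` is the projection on the odd part. -/
structure IsAxisWith (a : A) (l d : F) (φ : A →ₗ[F] F) (π : A →ₗ[F] A) : Prop where
  l_ne_zero : l ≠ 0
  d_ne_zero : d ≠ 0
  l_ne_one : l ≠ 1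
  d_ne_one : d ≠ 1
  coeff_self : φ a = 1
  odd_self : π a = 0
  mul_left : ∀ y, a * y = φ y • a + l • π y
  mul_right : ∀ y, y * a = φ y • a + d • π y
  odd_odd : ∀ y, π (π y) = π y
  coeff_odd : ∀ y, φ (π y) = 0
  odd_mul : ∀ x y, π (x * y) = x * π y + π x * y - (2 : F) • (π x * π y)

/-- The linearised flexibility defect `(x, y, z) + (z, y, x)`. -/
def flexDefect (x y z : A) : A := (x * y) * z - x * (y * z) + ((z * y) * x - z * (y * x))

theorem flexDefect_comm (x y z : A) : flexDefect x y z = flexDefect z y x := by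
  unfold flexDefect; abel

/-! ### Relations between two axes. -/

namespace IsAxisWith

variable {a b : A} {l d l' d' : F} {φ ψ : A →ₗ[F] F} {π ρ : A →ₗ[F] A}

theorem ne_zero (h : IsAxisWith a l d φ π) : a ≠ 0 := by
  rintro rfl
  simpa using h.coeff_self

theorem idem (h : IsAxisWith a l d φ π) : a * a = a := by
  simp [h.mul_left, h.coeff_self, h.odd_self]

theorem mul_odd (h : IsAxisWith a l d φ π) {v : A} (hv : π v = v) : a * v = l • v := by
  have := h.coeff_odd v
  rw [hv] at this
  rw [h.mul_left, this, hv, zero_smul, zero_add]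

theorem odd_mul' (h : IsAxisWith a l d φ π) {v : A} (hv : π v = v) : v * a = d • v := by
  have := h.coeff_odd v
  rw [hv] at this
  rw [h.mul_right, this, hv, zero_smul, zero_add]

/-- The Miyamoto involution of an axis with odd projection `π`. -/
def miyamoto (π : A →ₗ[F] A) : A →ₗ[F] A := LinearMap.id - (2 : F) • π

theorem miyamoto_apply (π : A →ₗ[F] A) (y : A) : miyamoto π y = y - (2 : F) • π y := rfl

theorem miyamoto_miyamoto (h : IsAxisWith a l d φ π) (y : A) :
    miyamoto π (miyamoto π y) = y := by
  simp only [miyamoto_apply, map_sub, map_smul, h.odd_odd]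
  module

/-- Applying `φ` to `a * ρ y = l' • ρ y` gives `φ (ρ y) = l' * φ (ρ y)`, so `φ` kills the other odd
part as `l' ≠ 1`. -/
theorem coeff_unique (h : IsAxisWith a l d φ π) (h' : IsAxisWith a l' d' ψ ρ) : φ = ψ := by
  ext y
  have h1 := congrArg φ ((h.mul_left y).symm.trans (h'.mul_left y))
  have h2 := congrArg φ ((h.mul_left (ρ y)).symm.trans (h'.mul_odd (h'.odd_odd y)))
  simp only [map_add, map_smul, smul_eq_mul, h.coeff_self, h.coeff_odd, mul_one, mul_zero,
    add_zero] at h1 h2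
  have h3 : (1 - l') * φ (ρ y) = 0 := by linear_combination h2
  have h4 := (mul_eq_zero.1 h3).resolve_left (sub_ne_zero.2 h'.l_ne_one.symm)
  rw [h1, h4, mul_zero, add_zero]

/-- Two axes, the first of which is not commutative, are equal, orthogonal, congruent modulo a
common odd part (and then of the same type), or of opposite types with the same odd part. -/
theorem classification (h : IsAxisWith a l d φ π)
    (h' : IsAxisWith b l' d' ψ ρ) (hld : l ≠ d) :
    a = b ∨ (φ b = 0 ∧ π b = 0 ∧ ψ a = 0 ∧ ρ a = 0) ∨
    (l' = l ∧ d' = d ∧ φ b = 1 ∧ ψ a = 1 ∧ b = a + π b ∧ a = b + ρ a) ∨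
    (l' = d ∧ d' = l ∧ φ b = 0 ∧ ψ a = 0 ∧ ρ a = π b) := by
  have e1 : φ b • a + l • π b = ψ a • b + d' • ρ a := by rw [← h.mul_left, ← h'.mul_right]
  have e2 : φ b • a + d • π b = ψ a • b + l' • ρ a := by rw [← h.mul_right, ← h'.mul_left]
  by_cases hu : π b = 0
  · rw [hu, smul_zero, add_zero] at e1 e2
    by_cases hw : ρ a = 0
    · rw [hw, smul_zero, add_zero] at e1
      by_cases hb : φ b = 0
      · rw [hb, zero_smul] at e1
        have := (smul_eq_zero.1 e1.symm).resolve_right h'.ne_zero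
        exact Or.inr (Or.inl ⟨hb, hu, this, hw⟩)
      · left
        have e3 := congrArg ψ e1
        simp only [map_smul, smul_eq_mul, h'.coeff_self, mul_one] at e3
        have e4 := congrArg φ e1
        simp only [map_smul, smul_eq_mul, h.coeff_self, mul_one] at e4
        have e5 : ψ a = 1 := by
          have : φ b * (ψ a - 1) = 0 := by linear_combination -e4
          exact sub_eq_zero.1 ((mul_eq_zero.1 this).resolve_left hb)
        rw [e5, mul_one] at e3
        rw [e5, e3, one_smul, one_smul] at e1
        exact e1
    · exfalso
      have e3 := congrArg ρ e2
      simp only [map_add, map_smul, h'.odd_self, h'.odd_odd, smul_zero, zero_add] at e3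
      have e4 : φ b = l' := smul_left_injective F hw e3
      have e5 := congrArg ψ e2
      simp only [map_add, map_smul, h'.coeff_self, h'.coeff_odd, smul_eq_mul, mul_one, mul_zero,
        add_zero, e4] at e5
      have e6 : ψ a = 0 := by
        have : (l' - 1) * ψ a = 0 := by linear_combination e5
        exact (mul_eq_zero.1 this).resolve_left (sub_ne_zero.2 h'.l_ne_one)
      rw [e4, e6, zero_smul, zero_add] at e2
      -- Now `a` would be odd for `b`, yet `a = a * a` is a product of odd elements, hence even.
      have e7 : a = ρ a := smul_right_injective A h'.l_ne_zero e2
      have e8 := h'.odd_mul a a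
      rw [← e7, h.idem, ← e7, two_smul] at e8
      simp at e8
      exact h.ne_zero e8
  · have e3 : (l - d) • π b = (d' - l') • ρ a := by
      linear_combination (norm := module) e1 - e2
    have hw : ρ a ≠ 0 := by
      intro hw
      rw [hw, smul_zero] at e3
      exact hu ((smul_eq_zero.1 e3).resolve_left (sub_ne_zero.2 hld))
    obtain ⟨k, hk⟩ : ∃ k : F, π b = k • ρ a := by
      refine ⟨(l - d)⁻¹ * (d' - l'), ?_⟩
      rw [mul_smul, ← e3, inv_smul_smul₀ (sub_ne_zero.2 hld)]
    have hk0 : k ≠ 0 := by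
      rintro rfl
      exact hu (by rw [hk, zero_smul])
    have hρu : ρ (π b) = π b := by rw [hk, map_smul, h'.odd_odd]
    have hπw : π (ρ a) = ρ a := by
      have := h.odd_odd b
      rw [hk, map_smul] at this
      exact smul_right_injective A hk0 this
    -- If `u = π b` is odd for both axes, the odd part of `b * u = l' • u` forces `u * u = 0`; then
    -- the odd part of `b * b = b` reads `(l' + d') • u = u`.
    have sum_eq_one : ∀ {a b : A} {l d l' d' : F} {φ ψ : A →ₗ[F] F} {π ρ : A →ₗ[F] A},
        IsAxisWith a l d φ π → IsAxisWith b l' d' ψ ρ → π b ≠ 0 → ρ (π b) = π b →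
        l' + d' = 1 := by
      intro a b l d l' d' φ ψ π ρ h h' hu hρu
      have f1 := h'.mul_odd hρu
      have f2 := h'.odd_mul' hρu
      have f3 := h.odd_mul b (π b)
      rw [h.odd_odd, f1, map_smul, h.odd_odd] at f3
      have f4 : π b * π b = 0 := by linear_combination (norm := module) f3
      have f5 := h.odd_mul b b
      rw [h'.idem, f1, f2, f4, smul_zero, sub_zero, ← add_smul] at f5
      exact (smul_left_injective F hu (by simpa using f5)).symm
    have s' := sum_eq_one h h' hu hρu
    have s := sum_eq_one h' h hw hπw
    have hk' : φ b + l * k = d' := by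
      have := congrArg ρ e1
      simp only [map_add, map_smul, h'.odd_self, h'.odd_odd, smul_zero, zero_add, hk] at this
      rw [smul_smul, ← add_smul] at this
      exact smul_left_injective F hw this
    have hk2 : φ b + d * k = l' := by
      have := congrArg ρ e2
      simp only [map_add, map_smul, h'.odd_self, h'.odd_odd, smul_zero, zero_add, hk] at this
      rw [smul_smul, ← add_smul] at this
      exact smul_left_injective F hw this
    have c1 := congrArg φ e1
    have c2 := congrArg ψ e1
    rw [← hπw] at c1
    rw [← hρu] at c2
    simp only [map_add, map_smul, smul_eq_mul, h.coeff_self, h'.coeff_self, h.coeff_odd,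
      h'.coeff_odd, mul_one, mul_zero, add_zero] at c1 c2
    have c3 : φ b = ψ a := by rw [c1, mul_comm, c2]
    have c4 : φ b * (φ b - 1) = 0 := by rw [← c3] at c2; linear_combination c2
    -- Adding `hk'` and `hk2` gives `2 φ b + k = 1`, so `k = 1` or `k = -1`.
    rcases mul_eq_zero.1 c4 with c5 | c5
    · have hk1 : k = 1 := by linear_combination hk' + hk2 - 2 * c5 - k * s + s'
      subst hk1
      refine Or.inr (Or.inr (Or.inr ⟨?_, ?_, c5, c3 ▸ c5, ?_⟩))
      · linear_combination c5 - hk2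
      · linear_combination c5 - hk'
      · rw [hk, one_smul]
    · have hk1 : k = -1 := by linear_combination hk' + hk2 - 2 * c5 - k * s + s'
      subst hk1
      have hb : φ b = 1 := sub_eq_zero.1 c5
      have ha : ψ a = 1 := c3 ▸ hb
      have hd : d' = d := by linear_combination c5 - hk' - s
      have hw2 : ρ a = -π b := by rw [hk]; module
      have hbu : b = a + π b := by
        rw [hb, ha, hw2, hd] at e1
        have : (l + d) • π b = π b := by rw [s, one_smul]
        linear_combination (norm := module) this - e1
      refine Or.inr (Or.inr (Or.inl ⟨?_, hd, hb, ha, hbu, ?_⟩))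
      · linear_combination c5 - hk2 - s
      · rw [hw2]; linear_combination (norm := module) -hbu

theorem coeff_odd_eq_zero (hF : (2 : F) ≠ 0) (hφ : φ ∘ₗ miyamoto ρ = φ) (v : A) :
    φ (ρ v) = 0 := by
  have := LinearMap.congr_fun hφ v
  rw [LinearMap.comp_apply, miyamoto_apply, map_sub, map_smul, sub_eq_self] at this
  exact (smul_eq_zero.1 this).resolve_left hF

/-- Congruent noncommutative axes have the same coefficient functional on every axis. -/
theorem coeff_eq_one_of_coeff_eq_one (h : IsAxisWith a l d φ π)
    (h' : IsAxisWith b l d ψ ρ) (hld : l ≠ d) (hab : φ b = 1) {c : A} {m n : F} {χ : A →ₗ[F] F}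
    {σ : A →ₗ[F] A} (hc : IsAxisWith c m n χ σ) (hac : φ c = 1) : ψ c = 1 := by
  rcases h'.classification hc hld with rfl | ⟨-, -, o1, o2⟩ | ⟨-, -, q, -⟩ | ⟨t1, t2, q, -⟩
  · exact h'.coeff_self
  · have hba : ψ a = 1 ∧ (a = b ∨ a = b + ρ a) := by
      rcases h.classification h' hld with rfl | ⟨r, -⟩ | ⟨-, -, -, r, -, r'⟩ | ⟨-, -, r, -⟩
      · exact ⟨h'.coeff_self, Or.inl rfl⟩
      · simp [hab] at r
      · exact ⟨r, Or.inr r'⟩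
      · simp [hab] at r
    rcases h.classification hc hld with rfl | ⟨r, -⟩ | ⟨-, -, -, r, -, r'⟩ | ⟨-, -, r, -⟩
    · exact hba.1
    · simp [hac] at r
    · exfalso
      rcases hba with ⟨ha1, rfl | ha2⟩
      · simp [r] at o1
      -- Were `b` and `c` orthogonal, `b * a = b * σ a` would be odd for `c`, so `χ` would vanish on
      -- it; but expanding `b * a` along `b` gives `χ (b * a) = l`.
      · have k1 : b * a = b * c + b * σ a := by rw [← mul_add, ← r']
        have k2 : b * c = 0 := by simp [hc.mul_right, o1, o2]
        have k3 := hc.odd_mul b (σ a)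
        simp only [o2, hc.odd_odd, zero_mul, smul_zero, add_zero, sub_zero] at k3
        have k4 := congrArg χ k1
        have hρ : χ (ρ a) = 1 := by
          have := congrArg χ ha2
          rw [map_add, o1, r, zero_add] at this
          exact this.symm
        rw [k2, zero_add, ← k3, hc.coeff_odd, h'.mul_left, map_add, map_smul, map_smul, o1, hρ,
          smul_zero, zero_add, smul_eq_mul, mul_one] at k4
        exact h.l_ne_zero k4
    · simp [hac] at r
  · exact q
  · exfalso
    rcases h.classification hc hld with rfl | ⟨r, -⟩ | ⟨r, -⟩ | ⟨-, -, r, -⟩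
    · rcases h.classification h' hld with rfl | ⟨r, -⟩ | ⟨-, -, -, r, -⟩ | ⟨-, -, r, -⟩
      · simp [h'.coeff_self] at q
      · simp [hab] at r
      · simp [q] at r
      · simp [hab] at r
    · simp [hac] at r
    · exact hld (r.symm.trans t1)
    · simp [hac] at r

theorem coeff_eq_zero_or_one (h : IsAxisWith a l d φ π)
    (h' : IsAxisWith b l' d' ψ ρ) (hld : l ≠ d) : φ b = 0 ∨ φ b = 1 := by
  rcases h.classification h' hld with rfl | ⟨r, -⟩ | ⟨-, -, r, -⟩ | ⟨-, -, r, -⟩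
  · exact Or.inr h.coeff_self
  · exact Or.inl r
  · exact Or.inr r
  · exact Or.inl r

end IsAxisWith

/-! ### From eigenspaces to the equational description. -/

variable [IsScalarTower F A A] [SMulCommClass F A A]

/-- By commutation, `R_a` preserves the kernel of `L_a`. Applying it twice isolates the
`d`-component of `y`, which vanishes by `zero_del`. -/
theorem IsPrimitiveAxis.mul_eq_zero_of_left {a : A} {l d : F} (h : IsPrimitiveAxis a l d) {y : A}
    (hy : a * y = 0) : y * a = 0 := by
  have hd0 := h.right.ne_zero
  have hd1 := h.right.ne_one
  have htop := h.right.fusion.isCompl.sup_eq_top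
  have hmem : y ∈ (rightEigenspace a (1 : F) ⊔ rightEigenspace a (0 : F)) ⊔
      rightEigenspace a d := htop ▸ Submodule.mem_top
  obtain ⟨e, he, v, hv, rfl⟩ := Submodule.mem_sup.1 hmem
  obtain ⟨s, hs, w, hw, rfl⟩ := Submodule.mem_sup.1 he
  rw [h.right.primitive] at hs
  obtain ⟨c, rfl⟩ := Submodule.mem_span_singleton.1 hs
  have hw' : w * a = 0 := by
    simpa [rightEigenspace, Module.End.mem_eigenspace_iff] using hw
  have hv' : v * a = d • v := by
    simpa [rightEigenspace, Module.End.mem_eigenspace_iff] using hv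
  have haa := h.left.idem
  have h1 : (c • a + w + v) * a = c • a + d • v := by
    simp [add_mul, smul_mul_assoc, haa, hw', hv']
  have h2 : a * (c • a + d • v) = 0 := by
    rw [← h1, h.comm, hy, zero_mul]
  have h3 : (c • a + d • v) * a = c • a + (d * d) • v := by
    simp [add_mul, smul_mul_assoc, haa, hv', smul_smul]
  have h4 : a * (c • a + (d * d) • v) = 0 := by
    rw [← h3, h.comm, h2, zero_mul]
  have h5 : (d * (d - 1)) • (a * v) = 0 := by
    simp only [mul_add, mul_smul_comm] at h2 h4
    linear_combination (norm := module) h4 - h2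
  have h6 : a * v = 0 := by
    simpa [hd0, sub_ne_zero.2 hd1] using h5
  have h7 : v ∈ leftEigenspace a (0 : F) ⊓ rightEigenspace a d :=
    ⟨by simpa [leftEigenspace, Module.End.mem_eigenspace_iff] using h6, hv⟩
  rw [h.zero_del, Submodule.mem_bot] at h7
  subst h7
  simp only [smul_zero, add_zero, mul_smul_comm, haa] at h2
  rw [h1, smul_zero, add_zero, h2]

theorem IsPrimitiveAxis.mul_eq_smul_of_left {a : A} {l d : F} (h : IsPrimitiveAxis a l d) {y : A}
    (hy : a * y = l • y) : y * a = d • y := by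
  have hd0 := h.right.ne_zero
  have hd1 := h.right.ne_one
  have hl1 := h.left.ne_one
  have htop := h.right.fusion.isCompl.sup_eq_top
  have hmem : y ∈ (rightEigenspace a (1 : F) ⊔ rightEigenspace a (0 : F)) ⊔
      rightEigenspace a d := htop ▸ Submodule.mem_top
  obtain ⟨e, he, v, hv, rfl⟩ := Submodule.mem_sup.1 hmem
  obtain ⟨s, hs, w, hw, rfl⟩ := Submodule.mem_sup.1 he
  rw [h.right.primitive] at hs
  obtain ⟨c, rfl⟩ := Submodule.mem_span_singleton.1 hs
  have hw' : w * a = 0 := by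
    simpa [rightEigenspace, Module.End.mem_eigenspace_iff] using hw
  have hv' : v * a = d • v := by
    simpa [rightEigenspace, Module.End.mem_eigenspace_iff] using hv
  have haa := h.left.idem
  have h1 : (c • a + w + v) * a = c • a + d • v := by
    simp [add_mul, smul_mul_assoc, haa, hw', hv']
  have h2 : a * (c • a + d • v) = l • (c • a + d • v) := by
    rw [← h1, h.comm, hy, smul_mul_assoc]
  have h3 : (c • a + d • v) * a = c • a + (d * d) • v := by
    simp [add_mul, smul_mul_assoc, haa, hv', smul_smul]
  have h4 : a * (c • a + (d * d) • v) = l • (c • a + (d * d) • v) := by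
    rw [← h3, h.comm, h2, smul_mul_assoc]
  simp only [mul_add, mul_smul_comm, haa] at hy h2 h4
  have h5 : (d * (d - 1)) • (a * v - l • v) = 0 := by
    linear_combination (norm := module) h4 - h2
  have h6 : a * v = l • v := by
    simpa [hd0, sub_ne_zero.2 hd1, sub_eq_zero] using h5
  have h7 : (c * (1 - l)) • a = 0 := by
    rw [h6] at h2
    linear_combination (norm := module) h2
  have h8 : c • a = 0 := by
    rw [mul_comm, mul_smul] at h7
    exact (smul_eq_zero.1 h7).resolve_left (sub_ne_zero.2 hl1.symm)
  rw [h8, zero_add, h6, smul_add, add_left_inj] at hy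
  have h9 : w ∈ leftEigenspace a l ⊓ rightEigenspace a (0 : F) :=
    ⟨by simpa [leftEigenspace, Module.End.mem_eigenspace_iff] using hy, hw⟩
  rw [h.lam_zero, Submodule.mem_bot] at h9
  rw [h1, h8, h9, zero_add, zero_add, zero_add]

theorem IsPrimitiveAxis.exists_isAxisWith {a : A} {l d : F} (h : IsPrimitiveAxis a l d)
    (ha : a ≠ 0) : ∃ φ π, IsAxisWith a l d φ π := by
  have hl0 := h.left.ne_zero
  have hl1 := h.left.ne_one
  have haa := h.left.idem
  have hk : l * (l - 1) ≠ 0 := mul_ne_zero hl0 (sub_ne_zero.2 hl1)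
  have dec : ∀ y, ∃ (c : F) (w v : A), y = c • a + w + v ∧ a * w = 0 ∧ w * a = 0 ∧
      a * v = l • v ∧ v * a = d • v := by
    intro y
    have hmem : y ∈ (leftEigenspace a (1 : F) ⊔ leftEigenspace a (0 : F)) ⊔
        leftEigenspace a l := h.left.fusion.isCompl.sup_eq_top ▸ Submodule.mem_top
    obtain ⟨e, he, v, hv, rfl⟩ := Submodule.mem_sup.1 hmem
    obtain ⟨s, hs, w, hw, rfl⟩ := Submodule.mem_sup.1 he
    rw [h.left.primitive] at hs
    obtain ⟨c, rfl⟩ := Submodule.mem_span_singleton.1 hs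
    have hw' : a * w = 0 := by
      simpa [leftEigenspace, Module.End.mem_eigenspace_iff] using hw
    have hv' : a * v = l • v := by
      simpa [leftEigenspace, Module.End.mem_eigenspace_iff] using hv
    exact ⟨c, w, v, rfl, hw', IsPrimitiveAxis.mul_eq_zero_of_left h hw', hv', IsPrimitiveAxis.mul_eq_smul_of_left h hv'⟩
  let L : A →ₗ[F] A := LinearMap.mulLeft F a
  -- Lagrange interpolation: `L² - L` kills the eigenvalues 0 and 1 and is `l * (l - 1)` on the odd
  -- part.
  let π : A →ₗ[F] A := (l * (l - 1))⁻¹ • (L ∘ₗ L - L)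
  have hπ : ∀ (c : F) (w v : A), a * w = 0 → a * v = l • v → π (c • a + w + v) = v := by
    intro c w v hw hv
    have : a * (a * (c • a + w + v)) - a * (c • a + w + v) = (l * (l - 1)) • v := by
      simp only [mul_add, mul_smul_comm, haa, hw, hv, mul_zero]
      module
    change (l * (l - 1))⁻¹ • (a * (a * (c • a + w + v)) - a * (c • a + w + v)) = v
    rw [this, inv_smul_smul₀ hk]
  let g : A →ₗ[F] A := L - l • π
  have hg : ∀ (c : F) (w v : A), a * w = 0 → a * v = l • v → g (c • a + w + v) = c • a := by
    intro c w v hw hv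
    change a * (c • a + w + v) - l • π (c • a + w + v) = c • a
    rw [hπ c w v hw hv]
    simp [mul_add, mul_smul_comm, haa, hw, hv]
  have hgm : ∀ y, g y ∈ Submodule.span F {a} := by
    intro y
    obtain ⟨c, w, v, rfl, hw, -, hv, -⟩ := dec y
    rw [hg c w v hw hv]
    exact Submodule.mem_span_singleton.2 ⟨c, rfl⟩
  let φ : A →ₗ[F] F := (LinearEquiv.coord F A a ha : _ →ₗ[F] F) ∘ₗ g.codRestrict _ hgm
  have hφ : ∀ (c : F) (w v : A), a * w = 0 → a * v = l • v → φ (c • a + w + v) = c := by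
    intro c w v hw hv
    have h1 : φ (c • a + w + v) • a = g (c • a + w + v) :=
      LinearEquiv.coord_apply_smul F A a ha ⟨_, hgm (c • a + w + v)⟩
    rw [hg c w v hw hv] at h1
    exact smul_left_injective F ha h1
  have hodd : ∀ v, a * v = l • v → π v = v := fun v hv => by simpa using hπ 0 0 v (by simp) hv
  have heven : ∀ (c : F) (w : A), a * w = 0 → π (c • a + w) = 0 := fun c w hw => by
    simpa using hπ c w 0 hw (by simp)
  have memE : ∀ (c : F) (w : A), a * w = 0 →
      c • a + w ∈ leftEigenspace a (1 : F) ⊔ leftEigenspace a (0 : F) := by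
    intro c w hw
    refine Submodule.add_mem_sup ?_ ?_
    · rw [h.left.primitive]; exact Submodule.mem_span_singleton.2 ⟨c, rfl⟩
    · simpa [leftEigenspace] using hw
  have memO : ∀ v, v ∈ leftEigenspace a l ↔ a * v = l • v := fun v => by
    simp [leftEigenspace, Module.End.mem_eigenspace_iff]
  have heven' : ∀ e ∈ leftEigenspace a (1 : F) ⊔ leftEigenspace a (0 : F), π e = 0 := by
    intro e he
    obtain ⟨s, hs, w, hw, rfl⟩ := Submodule.mem_sup.1 he
    rw [h.left.primitive] at hs
    obtain ⟨c, rfl⟩ := Submodule.mem_span_singleton.1 hs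
    exact heven c w (by simpa [leftEigenspace, Module.End.mem_eigenspace_iff] using hw)
  refine ⟨φ, π, hl0, h.right.ne_zero, hl1, h.right.ne_one, ?_, ?_, ?_, ?_, ?_, ?_, ?_⟩
  · simpa using hφ 1 0 0 (by simp) (by simp)
  · simpa using heven 1 0 (by simp)
  · intro y
    obtain ⟨c, w, v, rfl, hw, -, hv, -⟩ := dec y
    rw [hφ c w v hw hv, hπ c w v hw hv]
    simp [mul_add, mul_smul_comm, haa, hw, hv]
  · intro y
    obtain ⟨c, w, v, rfl, hw, hw', hv, hv'⟩ := dec y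
    rw [hφ c w v hw hv, hπ c w v hw hv]
    simp [add_mul, smul_mul_assoc, haa, hw', hv']
  · intro y
    obtain ⟨c, w, v, rfl, hw, -, hv, -⟩ := dec y
    rw [hπ c w v hw hv, hodd v hv]
  · intro y
    obtain ⟨c, w, v, rfl, hw, -, hv, -⟩ := dec y
    rw [hπ c w v hw hv]
    simpa using hφ 0 0 v (by simp) hv
  · intro x y
    obtain ⟨c, w, v, rfl, hw, -, hv, -⟩ := dec x
    obtain ⟨c', w', v', rfl, hw', -, hv', -⟩ := dec y
    rw [hπ c w v hw hv, hπ c' w' v' hw' hv']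
    have hE := memE c w hw
    have hE' := memE c' w' hw'
    generalize c • a + w = e at hE
    generalize c' • a + w' = e' at hE'
    have hv1 := (memO v).2 hv
    have hv1' := (memO v').2 hv'
    rw [add_mul e v, mul_add e, mul_add v, map_add, map_add, map_add,
      heven' _ (h.left.fusion.even_mul_even _ hE _ hE'),
      heven' _ (h.left.fusion.odd_mul_odd _ hv1 _ hv1'),
      hodd _ ((memO _).1 (h.left.fusion.even_mul_odd _ hE _ hv1')),
      hodd _ ((memO _).1 (h.left.fusion.odd_mul_even _ hv1 _ hE')), two_smul, add_mul e v]
    abel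

/-! ### Miyamoto conjugation and the flexibility defect. -/

namespace IsAxisWith

variable {a b : A} {l d l' d' : F} {φ ψ : A →ₗ[F] F} {π ρ : A →ₗ[F] A}

theorem flexible (h : IsAxisWith a l d φ π) (y : A) : (a * y) * a = a * (y * a) := by
  rw [h.mul_left, h.mul_right y, add_mul, mul_add, smul_mul_assoc, smul_mul_assoc, mul_smul_comm,
    mul_smul_comm, h.mul_odd (h.odd_odd y), h.odd_mul' (h.odd_odd y), smul_comm l d]

theorem miyamoto_mul (h : IsAxisWith a l d φ π) (x y : A) :
    miyamoto π (x * y) = miyamoto π x * miyamoto π y := by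
  simp only [miyamoto_apply, h.odd_mul, sub_mul, mul_sub, smul_mul_assoc, mul_smul_comm]
  module

theorem conj (h : IsAxisWith a l d φ π) (h' : IsAxisWith b l' d' ψ ρ) :
    IsAxisWith (miyamoto ρ a) l d (φ ∘ₗ miyamoto ρ) (miyamoto ρ ∘ₗ π ∘ₗ miyamoto ρ) where
  l_ne_zero := h.l_ne_zero
  d_ne_zero := h.d_ne_zero
  l_ne_one := h.l_ne_one
  d_ne_one := h.d_ne_one
  coeff_self := by simp [h'.miyamoto_miyamoto, h.coeff_self]
  odd_self := by simp [h'.miyamoto_miyamoto, h.odd_self]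
  mul_left y := by
    have := congrArg (miyamoto ρ) (h.mul_left (miyamoto ρ y))
    rw [h'.miyamoto_mul, h'.miyamoto_miyamoto, map_add, map_smul, map_smul] at this
    exact this
  mul_right y := by
    have := congrArg (miyamoto ρ) (h.mul_right (miyamoto ρ y))
    rw [h'.miyamoto_mul, h'.miyamoto_miyamoto, map_add, map_smul, map_smul] at this
    exact this
  odd_odd y := by simp [h'.miyamoto_miyamoto, h.odd_odd]
  coeff_odd y := by simp [h'.miyamoto_miyamoto, h.coeff_odd]
  odd_mul x y := by
    simp only [LinearMap.comp_apply, h'.miyamoto_mul, h.odd_mul, map_sub, map_add, map_smul,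
      h'.miyamoto_miyamoto]

theorem flexDefect_self (h : IsAxisWith a l d φ π) (y : A) : flexDefect a y a = 0 := by
  simp [flexDefect, h.flexible]

theorem flexDefect_of_eq_add_odd (hF : (2 : F) ≠ 0) (h : IsAxisWith a l d φ π)
    (h' : IsAxisWith b l' d' ψ ρ) (hb : b = a + π b) (y : A) : flexDefect a y b = 0 := by
  have hc := h'.conj h
  have hc2 : miyamoto π b = a - π b := by
    rw [miyamoto_apply]; nth_rewrite 1 [hb]; module
  have q1 := h.flexible y
  have q2 := h'.flexible y
  have q3 := hc.flexible y
  rw [hc2] at q3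
  unfold flexDefect
  rw [hb] at q2 ⊢
  rw [← hb] at q2 ⊢
  generalize π b = u at *
  subst hb
  simp only [add_mul, mul_add, sub_mul, mul_sub] at *
  have : (2 : F) • (a * y * a + a * y * u - (a * (y * a) + a * (y * u)) + (a * y * a + u * y * a -
      (a * (y * a) + u * (y * a)))) = 0 := by
    -- With `b = a + u`, subtracting the flexible laws of `a + u` and `a - u` leaves twice the part
    -- linear in `u`.
    linear_combination (norm := module) (4 : F) • q1 + q2 - q3
  exact (smul_eq_zero.1 this).resolve_left hF

/-- Here `z` annihilates `a` on both sides and multiplication by `z` commutes with `π`, so all odd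
terms cancel. -/
theorem flexDefect_of_even (h : IsAxisWith a l d φ π) {z : A} (hφ : φ z = 0) (hπ : π z = 0)
    (y : A) : flexDefect a y z = (φ (z * y) - φ (y * z)) • a := by
  have haz : a * z = 0 := by simp [h.mul_left, hφ, hπ]
  have hza : z * a = 0 := by simp [h.mul_right, hφ, hπ]
  have o1 := h.odd_mul y z
  have o2 := h.odd_mul z y
  rw [hπ] at o1 o2
  unfold flexDefect
  rw [h.mul_left (y * z), h.mul_right (z * y), h.mul_left y, h.mul_right y, o1, o2]
  simp only [add_mul, mul_add, smul_mul_assoc, mul_smul_comm, haz, hza, mul_zero, zero_mul]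
  module

end IsAxisWith

/-! ### Axes span the algebra. -/

/-- The set of nonzero primitive axes. -/
def axisSet (F A : Type*) [Field F] [NonUnitalNonAssocRing A] [Module F A] : Set A :=
  {a | ∃ (l d : F) (φ : A →ₗ[F] F) (π : A →ₗ[F] A), IsAxisWith a l d φ π}

theorem mul_mem_span_axisSet (hF : (2 : F) ≠ 0) {a b : A} (ha : a ∈ axisSet F A)
    (hb : b ∈ axisSet F A) : a * b ∈ Submodule.span F (axisSet F A) := by
  obtain ⟨l, d, φ, π, h⟩ := id ha
  obtain ⟨l', d', ψ, ρ, h'⟩ := id hb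
  have hπ : π b = (2 : F)⁻¹ • (b - IsAxisWith.miyamoto π b) := by
    rw [IsAxisWith.miyamoto_apply, sub_sub_cancel, inv_smul_smul₀ hF]
  rw [h.mul_left, hπ]
  refine add_mem (Submodule.smul_mem _ _ (Submodule.subset_span ha)) (Submodule.smul_mem _ _
    (Submodule.smul_mem _ _ (sub_mem (Submodule.subset_span hb) (Submodule.subset_span ?_))))
  exact ⟨_, _, _, _, h'.conj h⟩

theorem IsPAJ.span_axisSet (hF : (2 : F) ≠ 0) (hA : IsPAJ F A) :
    Submodule.span F (axisSet F A) = ⊤ := by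
  obtain ⟨X, hX, hgen⟩ := hA
  rw [eq_top_iff]
  rintro y -
  have hy : y ∈ NonUnitalAlgebra.adjoin F X := hgen ▸ trivial
  induction hy using NonUnitalAlgebra.adjoin_induction with
  | mem x hx =>
    -- Zero may be a generator, but it has no coefficient functional.
    by_cases h0 : x = 0
    · rw [h0]; exact zero_mem _
    · obtain ⟨l, d, h⟩ := hX x hx
      obtain ⟨φ, π, h'⟩ := h.exists_isAxisWith h0
      exact Submodule.subset_span ⟨l, d, φ, π, h'⟩
  | add x y _ _ hx hy => exact add_mem hx hy
  | zero => exact zero_mem _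
  | mul x y h1 h2 hx hy =>
    clear h1 h2
    induction hx using Submodule.span_induction with
    | mem a ha =>
      induction hy using Submodule.span_induction with
      | mem b hb => exact mul_mem_span_axisSet hF ha hb
      | zero => rw [mul_zero]; exact zero_mem _
      | add u v _ _ hu hv => rw [mul_add]; exact add_mem hu hv
      | smul r u _ hu => rw [mul_smul_comm]; exact Submodule.smul_mem _ _ hu
    | zero => rw [zero_mul]; exact zero_mem _
    | add u v _ _ hu hv => rw [add_mul]; exact add_mem hu hv
    | smul r u _ hu => rw [smul_mul_assoc]; exact Submodule.smul_mem _ _ hu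
  | smul r x _ hx => exact Submodule.smul_mem _ _ hx

/-! ### Vanishing of the defect. -/

namespace IsAxisWith

variable {a b : A} {l d l' d' : F} {φ ψ : A →ₗ[F] F} {π ρ : A →ₗ[F] A}

/-- Both functionals take only the values 0 and 1 on axes, which span, so it suffices to compare
where they equal 1. -/
theorem coeff_eq_of_coeff_eq_one
    (hspan : Submodule.span F (axisSet F A) = ⊤) (h : IsAxisWith a l d φ π)
    (h' : IsAxisWith b l d ψ ρ) (hld : l ≠ d) (hab : φ b = 1) : φ = ψ := by
  have hba : ψ a = 1 := h.coeff_eq_one_of_coeff_eq_one h' hld hab h h.coeff_self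
  refine LinearMap.ext_on hspan ?_
  rintro c ⟨m, n, χ, σ, hc⟩
  rcases h.coeff_eq_zero_or_one hc hld with h0 | h1
  · rcases h'.coeff_eq_zero_or_one hc hld with h0' | h1'
    · rw [h0, h0']
    · rw [h1', h'.coeff_eq_one_of_coeff_eq_one h hld hba hc h1']
  · rw [h1, h.coeff_eq_one_of_coeff_eq_one h' hld hab hc h1]

theorem flexDefect_eq_zero_of_ne (hF : (2 : F) ≠ 0)
    (hspan : Submodule.span F (axisSet F A) = ⊤) (h : IsAxisWith a l d φ π)
    (h' : IsAxisWith b l' d' ψ ρ) (hld : l ≠ d) (y : A) : flexDefect a y b = 0 := by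
  have hc := h.conj h'
  rcases h.classification h' hld with rfl | ⟨q1, q2, q3, q4⟩ | ⟨-, -, -, -, q, -⟩ |
    ⟨-, -, q1, q2, q3⟩
  · exact h.flexDefect_self y
  · have hm : miyamoto ρ a = a := by rw [miyamoto_apply, q4, smul_zero, sub_zero]
    have hφ := coeff_odd_eq_zero hF ((hm ▸ hc).coeff_unique h)
    rw [h.flexDefect_of_even q1 q2, h'.mul_left, h'.mul_right]
    simp [hφ, q1]
  · exact h.flexDefect_of_eq_add_odd hF h' q y
  -- Opposite types: the reflected axis `a - 2 π b` is congruent to `a`. This makes `φ` invariant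
  -- under the involution of `b` and kills the defect of `π b`; the even part `b - π b` remains.
  · have hm : miyamoto ρ a = a - (2 : F) • π b := by rw [miyamoto_apply, q3]
    have hc1 : φ (miyamoto ρ a) = 1 := by simp [hm, h.coeff_self, h.coeff_odd]
    have hφ := coeff_odd_eq_zero hF (h.coeff_eq_of_coeff_eq_one hspan hc hld hc1).symm
    have hfc : flexDefect a y (miyamoto ρ a) = 0 := by
      refine h.flexDefect_of_eq_add_odd hF hc ?_ y
      simp only [hm, map_sub, map_smul, h.odd_self, h.odd_odd]
      module
    have hfu : flexDefect a y (π b) = 0 := by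
      have h1 := h.flexDefect_self y
      rw [hm] at hfc
      unfold flexDefect at *
      simp only [sub_mul, mul_sub, smul_mul_assoc, mul_smul_comm] at *
      refine (smul_eq_zero_iff_right hF).1 ?_
      linear_combination (norm := module) h1 - hfc
    have hf0 : flexDefect a y (b - π b) = 0 := by
      have hp : π (b - π b) = 0 := by rw [map_sub, h.odd_odd, sub_self]
      rw [h.flexDefect_of_even (by rw [map_sub, h.coeff_odd, q1, sub_zero]) hp]
      have key : ∀ e, φ (b * e) = 0 ∧ φ (e * b) = 0 := fun e => by
        rw [h'.mul_left, h'.mul_right]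
        simp [hφ, q1]
      -- Modulo odd elements, `(b - π b) * y` is `b` times the even part of `y`, where `φ` vanishes
      -- by `key`.
      have k1 : (b - π b) * y = b * (y - π y) +
          (π ((b - π b) * π y) - π (π b * (y - π y))) := by
        rw [h.odd_mul, h.odd_mul, hp, map_sub, h.odd_odd, h.odd_odd, sub_self]
        simp only [zero_mul, mul_zero, smul_zero, sub_zero, add_zero, zero_add, sub_mul, mul_sub]
        abel
      have k2 : y * (b - π b) = (y - π y) * b +
          (π (π y * (b - π b)) - π ((y - π y) * π b)) := by
        rw [h.odd_mul, h.odd_mul, hp, map_sub, h.odd_odd, h.odd_odd, sub_self]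
        simp only [zero_mul, mul_zero, smul_zero, sub_zero, add_zero, zero_add, sub_mul, mul_sub]
        abel
      rw [k1, k2, map_add, map_add, (key _).1, (key _).2, map_sub, map_sub]
      simp [h.coeff_odd]
    unfold flexDefect at *
    simp only [sub_mul, mul_sub] at *
    linear_combination (norm := module) hfu + hf0

theorem flexDefect_eq_zero (hF : (2 : F) ≠ 0)
    (hspan : Submodule.span F (axisSet F A) = ⊤) (h : IsAxisWith a l d φ π)
    (h' : IsAxisWith b l' d' ψ ρ) (y : A) : flexDefect a y b = 0 := by
  by_cases hld : l = d
  · by_cases hld' : l' = d'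
    · subst hld hld'
      have ca : ∀ z, a * z = z * a := fun z => by rw [h.mul_left, h.mul_right]
      have cb : ∀ z, b * z = z * b := fun z => by rw [h'.mul_left, h'.mul_right]
      unfold flexDefect
      rw [← cb (a * y), ca y, ca (y * b), cb y]
      abel
    · rw [flexDefect_comm]
      exact h'.flexDefect_eq_zero_of_ne hF hspan h hld' y
  · exact h.flexDefect_eq_zero_of_ne hF hspan h' hld y

end IsAxisWith

theorem flexDefect_eq_zero_of_span_axisSet (hF : (2 : F) ≠ 0)
    (hspan : Submodule.span F (axisSet F A) = ⊤) (x y z : A) : flexDefect x y z = 0 := by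
  have hx : x ∈ Submodule.span F (axisSet F A) := hspan ▸ Submodule.mem_top
  have hz : z ∈ Submodule.span F (axisSet F A) := hspan ▸ Submodule.mem_top
  have add_right : ∀ x u v : A, flexDefect x y u = 0 → flexDefect x y v = 0 →
      flexDefect x y (u + v) = 0 := by
    intro x u v hu hv
    unfold flexDefect at *
    simp only [add_mul, mul_add]
    linear_combination (norm := module) hu + hv
  have smul_right : ∀ (r : F) (x u : A), flexDefect x y u = 0 → flexDefect x y (r • u) = 0 := by
    intro r x u hu
    unfold flexDefect at *
    simp only [smul_mul_assoc, mul_smul_comm]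
    linear_combination (norm := module) r • hu
  induction hx using Submodule.span_induction with
  | mem a ha =>
    obtain ⟨l, d, φ, π, h⟩ := ha
    induction hz using Submodule.span_induction with
    | mem b hb =>
      obtain ⟨l', d', ψ, ρ, h'⟩ := hb
      exact h.flexDefect_eq_zero hF hspan h' y
    | zero => simp [flexDefect]
    | add u v _ _ hu hv => exact add_right _ _ _ hu hv
    | smul r u _ hu => exact smul_right _ _ _ hu
  | zero => simp [flexDefect]
  | add u v _ _ hu hv =>
    rw [flexDefect_comm] at *
    exact add_right _ _ _ hu hv
  | smul r u _ hu =>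
    rw [flexDefect_comm] at *
    exact smul_right _ _ _ hu

end Axes

theorem mainTheorem4 {F A : Type*} [Field F] [NonUnitalNonAssocRing A] [Module F A]
    [IsScalarTower F A A] [SMulCommClass F A A] (hF : (2 : F) ≠ 0) (hA : IsPAJ F A) :
    ∀ x y : A, (x * y) * x = x * (y * x) := by
  intro x y
  have h := flexDefect_eq_zero_of_span_axisSet hF (hA.span_axisSet hF) x y x
  rw [flexDefect, ← two_smul F] at h
  exact sub_eq_zero.1 ((smul_eq_zero.1 h).resolve_left hF)
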